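/- Let $k$ be an algebraically closed field of characteristic $0$ and let $(R,\mathfrak m_R,k)$ be a complete Noetherian local $k$-algebra with residue field $k$ which is a domain of Krull dimension one. Let $K$ be the fraction field of $R$, $\overline R$ the integral closure of $R$ in $K$ (so $\overline R\cong k[[t]]$ is a discrete valuation ring, with order function $\operatorname{ord}$), and let $\mathfrak C_R=R:_K\overline R$ be the conductor. Let $x_1\in\mathfrak m_R$ be an element of least order, i.e. every element of $\mathfrak m_R$ is divisible by $x_1$ in $\overline R$. Put $n=\operatorname{edim}R$, let $$s=\dim_k\frac{(\mathfrak C_R,x_1)}{(x_1)}$$ be the reduced type of $R$, and let $S=R\left[\frac{\mathfrak C_R}{x_1}\right]\subseteq K$ be the ring obtained from $R$ by adjoining all $c/x_1$ with $c\in\mathfrak C_R$. Here $\operatorname{edim}A=\dim_{\kappa}\mathfrak m_A/\mathfrak m_A^2$ and $\operatorname{type}(A)=\dim_\kappa\operatorname{Ext}_A^{\operatorname{depth}A}(\kappa,A)$ for a Noetherian local ring $A$ with maximal ideal $\mathfrak m_A$ and residue field $\kappa$. If $\mathfrak C_R\subseteq\mathfrak m_R^2$, then $S$ is a Noetherian local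 ring with $\operatorname{edim}(S)=n+s$, and $$\operatorname{type}(S)\le\operatorname{type}(R)+s(n-1).$$ -/

import Mathlib

open IsLocalRing CategoryTheory

noncomputable section

universe u v

/-- The embedding dimension `edim A = dim_κ 𝔪/𝔪²` of a local ring `A` with residue field `κ`. -/
def edim (A : Type u) [CommRing A] [IsLocalRing A] : ℕ :=
  Module.finrank (ResidueField A) (CotangentSpace A)

/-- The module `Ext^i_A(κ, A)`, where `κ` is the residue field of the local ring `A`. -/
abbrev residueExt (A : Type u) [CommRing A] [IsLocalRing A] (i : ℕ) : Type u :=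
  Abelian.Ext (ModuleCat.of A (ResidueField A)) (ModuleCat.of A A) i

/-- The depth of a (Noetherian) local ring `A`: the least `i` such that `Ext^i_A(κ, A) ≠ 0`. -/
def localDepth (A : Type u) [CommRing A] [IsLocalRing A] : ℕ :=
  sInf {i : ℕ | Nontrivial (residueExt A i)}

/-- The type of a (Noetherian) local ring `A`: the dimension over the residue field `κ` of
`Ext^d_A(κ, A)`, where `d = depth A`.  As this module is annihilated by the maximal ideal, its
dimension over `κ` is its length as an `A`-module. -/
def cmType (A : Type u) [CommRing A] [IsLocalRing A] : ℕ∞ :=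
  Module.length A (residueExt A (localDepth A))

/-- The conductor `R :_K R̄` of a domain `R` in its integral closure `R̄` in its field of
fractions `K`, as an ideal of `R` (it is contained in `R` because `1 ∈ R̄`). -/
def conductorIdeal (R : Type u) (K : Type v) [CommRing R] [Field K] [Algebra R K] : Ideal R :=
  Submodule.comap (Algebra.linearMap R K)
    ((1 : Submodule R K) / Subalgebra.toSubmodule (integralClosure R K))

/-- `x` is an element of least order in the maximal ideal of `R`: every element of the maximal
ideal is divisible by `x` in the integral closure `R̄` of `R` in `K`.  When `R̄` is a discrete
valuation ring, divisibility in `R̄` is the comparison of orders. -/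
def IsOfLeastOrder (R : Type u) (K : Type v) [CommRing R] [IsLocalRing R] [Field K] [Algebra R K]
    (x : R) : Prop :=
  x ∈ maximalIdeal R ∧ ∀ y ∈ maximalIdeal R,
    algebraMap R (integralClosure R K) x ∣ algebraMap R (integralClosure R K) y

/-- The reduced type `dim_k (C, x)/(x)`, where `C` is the conductor of `R`; here `(C, x)/(x)` is
the image of the ideal `(C, x)` in `R/(x)`. -/
def reducedType (k : Type*) (R : Type u) (K : Type v) [Field k] [CommRing R] [Algebra k R]
    [Field K] [Algebra R K] (x : R) : ℕ :=
  Module.finrank k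
    ((conductorIdeal R K ⊔ Ideal.span {x}).map (Ideal.Quotient.mk (Ideal.span {x})))

/-- The ring `R[C/x] ⊆ K` obtained from `R` by adjoining all `c/x` with `c` in the conductor. -/
def conductorTransform (R : Type u) (K : Type v) [CommRing R] [Field K] [Algebra R K] (x : R) :
    Subalgebra R K :=
  Algebra.adjoin R {z : K | ∃ c ∈ conductorIdeal R K, z = algebraMap R K c / algebraMap R K x}

end

/-! Write `𝔪` for the maximal ideal of `R`, `R̄` for its integral closure, `C` for the conductor and
`x` for the element of least order. Since `𝔪 ⊆ xR̄`, the hypothesis `C ⊆ 𝔪²` gives `C ⊆ x²R̄`, so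
`C/x ⊆ xR̄`. As `C` is an ideal of `R̄`, both `(C/x)²` and `𝔪·(C/x)` lie in `C ⊆ 𝔪²`. Hence `S = R +
C/x` is local with maximal ideal `𝔪_S = 𝔪 + C/x`, and `𝔪_S² = 𝔪²` as subsets of `K`. Multiplication
by `x` identifies `S/R` with `(C, x)/(x)`, of length `s`, and `𝔪_S/𝔪 ≅ S/R`. The chain `𝔪² ⊆ 𝔪 ⊆
𝔪_S` then gives `edim S = n + s`.

For the type, a one-dimensional Noetherian local domain `A` has depth one, and `Ext¹(κ, A) ≅ (A :
𝔪_A)/A`, the colon taken in a field containing `A`. Let `T = S : 𝔪_S`. Multiplying by `n` generators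
of `𝔪` maps `T` to `(S/R)ⁿ` with kernel `T ∩ (R : 𝔪)`. Counting `R`-lengths in `R ⊆ T ∩ (R : 𝔪) ⊆ T`
and in `R ⊆ S ⊆ T` gives `type S + s ≤ type R + ns`. The count is
`length_colonMaximalIdeal_conductorTransform_add_le`; the identification of the type is
`cmType_eq_length`. -/

/-! ### Comparison of module lengths -/

section Length

variable {R M N P : Type*} [Ring R] [AddCommGroup M] [Module R M] [AddCommGroup N] [Module R N]
  [AddCommGroup P] [Module R P]

theorem length_eq_of_surjective_of_ker_eq {f : M →ₗ[R] N} {g : M →ₗ[R] P}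
    (hf : Function.Surjective f) (hg : Function.Surjective g)
    (h : LinearMap.ker f = LinearMap.ker g) : Module.length R N = Module.length R P := by
  rw [← (f.quotKerEquivOfSurjective hf).length_eq, ← (g.quotKerEquivOfSurjective hg).length_eq, h]

/-- `M/A` is a quotient of `M/ker g`, which embeds in `N`. -/
theorem length_quotient_le_of_ker_le {A : Submodule R M} (g : M →ₗ[R] N)
    (h : LinearMap.ker g ≤ A) : Module.length R (M ⧸ A) ≤ Module.length R N := by
  refine le_trans ?_ (Module.length_le_of_injective ((LinearMap.ker g).liftQ g le_rfl)
    (LinearMap.ker_eq_bot.mp (Submodule.ker_liftQ_eq_bot _ _ _ le_rfl)))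
  exact Module.length_le_of_surjective (Submodule.factor h) (Submodule.factor_surjective h)

theorem length_quotient_submoduleOf_add {A B D : Submodule R M} (hAB : A ≤ B) (hBD : B ≤ D) :
    Module.length R (D ⧸ A.submoduleOf D) =
      Module.length R (B ⧸ A.submoduleOf B) + Module.length R (D ⧸ B.submoduleOf D) := by
  have h1 : A.submoduleOf B ≤ (A.submoduleOf D).comap (Submodule.inclusion hBD) := fun z hz ↦ hz
  have h2 : A.submoduleOf D ≤ B.submoduleOf D := fun z hz ↦ hAB hz
  refine Module.length_eq_add_of_exact
    (Submodule.mapQ _ _ (Submodule.inclusion hBD) h1) (Submodule.factor h2) ?_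
    (Submodule.factor_surjective h2) ?_
  · rw [← LinearMap.ker_eq_bot, Submodule.mapQ, Submodule.ker_liftQ_eq_bot]
    intro z hz
    exact (Submodule.Quotient.mk_eq_zero (A.submoduleOf D)).mp hz
  · intro z
    obtain ⟨z, rfl⟩ := Submodule.mkQ_surjective _ z
    constructor
    · intro hz
      have hz' : (z : M) ∈ B := (Submodule.Quotient.mk_eq_zero (B.submoduleOf D)).mp hz
      exact ⟨Submodule.Quotient.mk ⟨z, hz'⟩, rfl⟩
    · rintro ⟨w, hw⟩
      obtain ⟨w, rfl⟩ := Submodule.mkQ_surjective _ w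
      rw [← hw]
      exact (Submodule.Quotient.mk_eq_zero (B.submoduleOf D)).mpr w.2

/-- A chain of `S`-submodules is also a chain of `R`-submodules. -/
theorem length_le_length_of_isScalarTower {S : Type*} [Ring S] [SMul R S] [Module S M]
    [IsScalarTower R S M] : Module.length S M ≤ Module.length R M := by
  rw [← WithBot.coe_le_coe, Module.coe_length, Module.coe_length]
  exact Order.krullDim_le_of_orderEmbedding (Submodule.restrictScalarsEmbedding R S M)

end Length

/-! ### Depth and type of a one-dimensional local domain -/

section ResidueExt

universe u v

variable {A : Type u} [CommRing A] [IsLocalRing A]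

/-- The short complex `𝔪 → A → κ`. -/
noncomputable abbrev residueShortComplex (A : Type u) [CommRing A] [IsLocalRing A] :
    ShortComplex (ModuleCat.{u} A) :=
  ShortComplex.mk (X₁ := ModuleCat.of A (maximalIdeal A)) (X₂ := ModuleCat.of A A)
    (X₃ := ModuleCat.of A (ResidueField A))
    (ModuleCat.ofHom (maximalIdeal A).subtype)
    (ModuleCat.ofHom (Algebra.linearMap A (ResidueField A))) (by
      ext z
      simp)

theorem residueShortComplex_shortExact : (residueShortComplex A).ShortExact := by
  have h1 : Mono (residueShortComplex A).f := by
    rw [ModuleCat.mono_iff_injective]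
    exact Subtype.val_injective
  have h2 : Epi (residueShortComplex A).g := by
    rw [ModuleCat.epi_iff_surjective]
    exact IsLocalRing.residue_surjective
  refine ⟨?_⟩
  rw [ShortComplex.moduleCat_exact_iff]
  intro z hz
  exact ⟨⟨z, (residue_eq_zero_iff (R := A) z).mp hz⟩, rfl⟩

/-- The connecting map `Hom(𝔪, A) → Ext¹(κ, A)`. -/
noncomputable def homMaximalIdealToExt (A : Type u) [CommRing A] [IsLocalRing A] :
    (maximalIdeal A →ₗ[A] A) →ₗ[A] residueExt A 1 where
  toFun f := (residueShortComplex_shortExact (A := A)).extClass.comp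
    (Abelian.Ext.mk₀ (ModuleCat.ofHom f : (residueShortComplex A).X₁ ⟶ ModuleCat.of A A))
    (add_zero 1)
  map_add' f g := by
    rw [← Abelian.Ext.comp_add, ← Abelian.Ext.mk₀_add, ← ModuleCat.ofHom_add]
  map_smul' r f := by
    rw [RingHom.id_apply, ← Abelian.Ext.comp_smul, ← Abelian.Ext.mk₀_smul]
    rfl

/-- The next term of the long exact sequence is `Ext¹(A, A)`, which vanishes because `A` is
projective. -/
theorem homMaximalIdealToExt_surjective : Function.Surjective (homMaximalIdealToExt A) := by
  intro e
  have hp : Projective (residueShortComplex A).X₂ :=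
    (IsProjective.iff_projective (R := A) A).mp inferInstance
  obtain ⟨y, hy⟩ := Abelian.Ext.contravariant_sequence_exact₃
    (residueShortComplex_shortExact (A := A)) (ModuleCat.of A A) e
    (Abelian.Ext.eq_zero_of_projective _) (add_zero 1)
  obtain ⟨g, rfl⟩ := (Abelian.Ext.mk₀_bijective _ _).2 y
  exact ⟨g.hom, hy⟩

theorem mem_ker_homMaximalIdealToExt (f : maximalIdeal A →ₗ[A] A) :
    f ∈ LinearMap.ker (homMaximalIdealToExt A) ↔ ∃ a : A, ∀ m, f m = m * a := by
  rw [LinearMap.mem_ker]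
  constructor
  · intro h
    obtain ⟨y, hy⟩ := Abelian.Ext.contravariant_sequence_exact₁
      (residueShortComplex_shortExact (A := A)) (ModuleCat.of A A) _ (add_zero 1) h
    obtain ⟨g, rfl⟩ := (Abelian.Ext.mk₀_bijective _ _).2 y
    rw [Abelian.Ext.mk₀_comp_mk₀] at hy
    have hy' := (Abelian.Ext.mk₀_bijective _ _).1 hy
    refine ⟨g.hom (1 : A), fun m ↦ ?_⟩
    have h3 : f m = g.hom (m : A) := (congrArg (fun q ↦ q.hom m) hy').symm
    rw [h3]
    have := g.hom.map_smul (m : A) (1 : A)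
    rwa [smul_eq_mul, mul_one] at this
  · rintro ⟨a, ha⟩
    have hf : (ModuleCat.ofHom f : (residueShortComplex A).X₁ ⟶ ModuleCat.of A A) =
        (residueShortComplex A).f ≫ ModuleCat.ofHom (LinearMap.toSpanSingleton A A a) := by
      ext m
      exact ha m
    change Abelian.Ext.comp _ _ (add_zero 1) = 0
    rw [hf, ← Abelian.Ext.mk₀_comp_mk₀]
    exact (residueShortComplex_shortExact (A := A)).extClass_comp_assoc _

variable {F : Type v} [Field F] [Algebra A F]

/-- The fractional ideal `A :_F 𝔪`. -/
noncomputable def colonMaximalIdeal (A : Type u) (F : Type v) [CommRing A] [IsLocalRing A] [Field F]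
    [Algebra A F] : Submodule A F :=
  (1 : Submodule A F) / Submodule.map (Algebra.linearMap A F) (maximalIdeal A)

theorem mem_colonMaximalIdeal {z : F} : z ∈ colonMaximalIdeal A F ↔
    ∀ m ∈ maximalIdeal A, ∃ a : A, algebraMap A F a = z * algebraMap A F m := by
  simp [colonMaximalIdeal, Submodule.mem_div_iff_forall_mul_mem, Submodule.mem_one,
    -mem_maximalIdeal]

theorem one_le_colonMaximalIdeal : 1 ≤ colonMaximalIdeal A F := by
  intro z hz
  obtain ⟨a, rfl⟩ := Submodule.mem_one.mp hz
  exact mem_colonMaximalIdeal.mpr fun m _ ↦ ⟨a * m, by simp⟩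

/-- Fix `a ≠ 0` in `𝔪`. From `a f(m) = m f(a)`, each `f : 𝔪 → A` is multiplication by `f(a)/a`, so
`Hom(𝔪, A) ≅ A : 𝔪`. The kernel of the connecting map consists of the multiplications by elements of
`A`. -/
theorem length_residueExt_one [FaithfulSMul A F] (hA : maximalIdeal A ≠ ⊥) :
    Module.length A (residueExt A 1) =
      Module.length A (colonMaximalIdeal A F ⧸
        (1 : Submodule A F).submoduleOf (colonMaximalIdeal A F)) := by
  have hinj := FaithfulSMul.algebraMap_injective A F
  obtain ⟨a, ham, ha0⟩ := Submodule.exists_mem_ne_zero_of_ne_bot hA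
  have haF : algebraMap A F a ≠ 0 := by simpa using ha0
  let ψ : (maximalIdeal A →ₗ[A] A) →ₗ[A] F :=
    (LinearMap.mulRight A (algebraMap A F a)⁻¹) ∘ₗ Algebra.linearMap A F ∘ₗ
      LinearMap.applyₗ (⟨a, ham⟩ : maximalIdeal A)
  have hψ (f : maximalIdeal A →ₗ[A] A) (m : maximalIdeal A) :
      algebraMap A F (f m) = ψ f * algebraMap A F m := by
    have h1 : a * f m = m * f ⟨a, ham⟩ := by
      rw [← smul_eq_mul, ← smul_eq_mul, ← map_smul, ← map_smul]
      congr 1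
      ext
      simp [mul_comm]
    have h2 := congrArg (algebraMap A F) h1
    simp only [map_mul] at h2
    simp only [ψ, LinearMap.comp_apply, LinearMap.mulRight_apply, LinearMap.applyₗ_apply_apply,
      Algebra.linearMap_apply]
    field_simp
    linear_combination h2
  have hmem (f) : ψ f ∈ colonMaximalIdeal A F :=
    mem_colonMaximalIdeal.mpr fun m hm ↦ ⟨f ⟨m, hm⟩, hψ f ⟨m, hm⟩⟩
  refine length_eq_of_surjective_of_ker_eq (homMaximalIdealToExt_surjective (A := A))
    (g := Submodule.mkQ _ ∘ₗ ψ.codRestrict _ hmem) ?_ ?_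
  · refine (Submodule.mkQ_surjective _).comp ?_
    rintro ⟨z, hz⟩
    have hz' := mem_colonMaximalIdeal.mp hz
    choose g hg using hz'
    refine ⟨{ toFun := fun m ↦ g m m.2, map_add' := ?_, map_smul' := ?_ }, ?_⟩
    · intro m m'
      apply hinj
      simp only [map_add, hg, Submodule.coe_add, mul_add]
    · intro r m
      apply hinj
      simp [hg]
      ring
    · ext
      simp [ψ, hg, haF]
  · ext f
    rw [mem_ker_homMaximalIdealToExt]
    rw [LinearMap.mem_ker, LinearMap.comp_apply, Submodule.mkQ_apply,
      Submodule.Quotient.mk_eq_zero]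
    change _ ↔ ψ f ∈ (1 : Submodule A F)
    rw [Submodule.mem_one]
    refine exists_congr fun b ↦ ⟨fun h ↦ ?_, fun h m ↦ ?_⟩
    · have := hψ f ⟨a, ham⟩
      rw [h, map_mul, mul_comm] at this
      exact mul_right_cancel₀ haF this
    · apply hinj
      rw [hψ, ← h, map_mul, mul_comm]

/-- An associated prime of `A/(a)` contains `a ≠ 0`, so it is `𝔪` by dimension one. If it is the
annihilator of the class of `b`, then `b/a` is the required element. -/
theorem exists_mem_colonMaximalIdeal_notMem_one [IsNoetherianRing A] [IsDomain A]
    [Ring.DimensionLEOne A] [FaithfulSMul A F] (hA : maximalIdeal A ≠ ⊥) :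
    ∃ z ∈ colonMaximalIdeal A F, z ∉ (1 : Submodule A F) := by
  obtain ⟨a, ham, ha0⟩ := Submodule.exists_mem_ne_zero_of_ne_bot hA
  have haF : algebraMap A F a ≠ 0 := by simpa using ha0
  have : Nontrivial (A ⧸ Ideal.span {a}) := Ideal.Quotient.nontrivial_iff.mpr
    fun h ↦ (mem_maximalIdeal a).mp ham (Ideal.span_singleton_eq_top.mp h)
  obtain ⟨P, hP⟩ := associatedPrimes.nonempty A (A ⧸ Ideal.span {a})
  obtain ⟨hprime, y, hy⟩ := isAssociatedPrime_iff.mp hP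
  obtain ⟨b, rfl⟩ := Ideal.Quotient.mk_surjective y
  have hmemP (c : A) : c ∈ P ↔ c * b ∈ Ideal.span {a} := by
    rw [hy, Submodule.mem_colon_singleton, Submodule.mem_bot, ← Ideal.Quotient.eq_zero_iff_mem,
      map_mul]
    rfl
  have haP : a ∈ P := (hmemP a).mpr (Ideal.mul_mem_right _ _ (Ideal.mem_span_singleton_self a))
  have hP0 : P ≠ ⊥ := fun h ↦ ha0 (by simpa [h] using haP)
  have hPmax : P = maximalIdeal A := eq_maximalIdeal (hprime.isMaximal hP0)
  refine ⟨algebraMap A F b / algebraMap A F a, mem_colonMaximalIdeal.mpr fun m hm ↦ ?_, ?_⟩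
  · rw [← hPmax, hmemP] at hm
    obtain ⟨d, hd⟩ := Ideal.mem_span_singleton.mp hm
    refine ⟨d, ?_⟩
    have := congrArg (algebraMap A F) hd
    rw [map_mul, map_mul] at this
    field_simp
    linear_combination -this
  · intro h
    obtain ⟨d, hd⟩ := Submodule.mem_one.mp h
    have h1 : b = d * a := by
      apply FaithfulSMul.algebraMap_injective A F
      rw [map_mul, hd, div_mul_cancel₀ _ haF]
    refine hprime.ne_top ((Ideal.eq_top_iff_one _).mpr ((hmemP 1).mpr ?_))
    rw [one_mul, h1]
    exact Ideal.mem_span_singleton.mpr (dvd_mul_left _ _)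

/-- A map `κ → A` has values killed by a nonzero element of the domain `A`, so `Ext⁰` vanishes;
`Ext¹` does not, since `A : 𝔪` is strictly larger than `A`. -/
theorem localDepth_eq_one [IsNoetherianRing A] [IsDomain A]
    [Ring.DimensionLEOne A] (hA : maximalIdeal A ≠ ⊥) : localDepth A = 1 := by
  have h0 : ¬ Nontrivial (residueExt A 0) := by
    rw [not_nontrivial_iff_subsingleton]
    have : Subsingleton (ModuleCat.of A (ResidueField A) ⟶ ModuleCat.of A A) := by
      refine ⟨fun f g ↦ ?_⟩
      have key (f : ModuleCat.of A (ResidueField A) ⟶ ModuleCat.of A A) : f = 0 := by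
        obtain ⟨a, ham, ha0⟩ := Submodule.exists_mem_ne_zero_of_ne_bot hA
        ext z
        have h1 : a • z = 0 := by
          change residue A a * z = 0
          rw [(residue_eq_zero_iff (R := A) a).mpr ham, zero_mul]
        have h2 : a * f.hom z = 0 := by
          rw [← smul_eq_mul, ← map_smul, h1, map_zero]
        exact (mul_eq_zero.mp h2).resolve_left ha0
      rw [key f, key g]
    exact (Abelian.Ext.homEquiv₀ (X := ModuleCat.of A (ResidueField A))
      (Y := ModuleCat.of A A)).subsingleton
  have h1 : Nontrivial (residueExt A 1) := by
    rw [← Module.length_pos_iff (R := A), length_residueExt_one (F := FractionRing A) hA,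
      Module.length_pos_iff, Submodule.Quotient.nontrivial_iff]
    intro h
    obtain ⟨z, hz, hz1⟩ := exists_mem_colonMaximalIdeal_notMem_one (F := FractionRing A) hA
    exact hz1 (Submodule.submoduleOf_eq_top.mp h hz)
  refine le_antisymm (Nat.sInf_le h1) (le_csInf ⟨1, h1⟩ ?_)
  intro i hi
  by_contra hlt
  obtain rfl : i = 0 := by omega
  exact h0 hi

theorem cmType_eq_length [IsNoetherianRing A] [IsDomain A]
    [Ring.DimensionLEOne A] [FaithfulSMul A F] (hA : maximalIdeal A ≠ ⊥) :
    cmType A = Module.length A (colonMaximalIdeal A F ⧸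
        (1 : Submodule A F).submoduleOf (colonMaximalIdeal A F)) := by
  rw [cmType, localDepth_eq_one hA, length_residueExt_one (F := F) hA]

end ResidueExt

/-! ### Embedding dimension as a length over a base ring -/

section EmbeddingDimension

variable {R S V : Type*} [CommRing R] [CommRing S] [IsLocalRing S] [Algebra R S] [AddCommGroup V]
  [Module R V]

theorem edim_eq_length_cotangentSpace [IsNoetherianRing S]
    (hres : Function.Surjective (algebraMap R (ResidueField S))) :
    (edim S : ℕ∞) = Module.length R (CotangentSpace S) := by
  have : IsScalarTower R (ResidueField S) (CotangentSpace S) :=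
    IsScalarTower.of_algebraMap_smul fun r t ↦ by
      rw [IsScalarTower.algebraMap_apply R S (ResidueField S), algebraMap_smul, algebraMap_smul]
  rw [Module.length_eq_of_surjective (R := ResidueField S) hres, Module.length_eq_finrank, edim]

/-- Realises the cotangent space of `S` inside an ambient `R`-module. With `V = K`, the cotangent
spaces of `R` and of its overring become comparable. -/
theorem edim_eq_length_quotient [IsNoetherianRing S]
    (hres : Function.Surjective (algebraMap R (ResidueField S))) (f : S →ₗ[R] V)
    {M N : Submodule R V} (hM : ∀ s, f s ∈ M ↔ s ∈ maximalIdeal S) (hrange : M ≤ LinearMap.range f)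
    (hN : ∀ s, f s ∈ N ↔ s ∈ maximalIdeal S ^ 2) :
    (edim S : ℕ∞) = Module.length R (M ⧸ N.submoduleOf M) := by
  rw [edim_eq_length_cotangentSpace (R := R) hres]
  let g : maximalIdeal S →ₗ[R] M :=
    (f ∘ₗ (maximalIdeal S).subtype.restrictScalars R).codRestrict M fun s ↦ (hM s).mpr s.2
  refine length_eq_of_surjective_of_ker_eq
    (f := (maximalIdeal S).toCotangent.restrictScalars R) (g := (N.submoduleOf M).mkQ ∘ₗ g)
    (maximalIdeal S).toCotangent_surjective ?_ ?_
  · refine (Submodule.mkQ_surjective _).comp fun ⟨z, hz⟩ ↦ ?_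
    obtain ⟨s, rfl⟩ := hrange hz
    exact ⟨⟨s, (hM s).mp hz⟩, rfl⟩
  · ext s
    rw [LinearMap.mem_ker, LinearMap.mem_ker, LinearMap.comp_apply, Submodule.mkQ_apply,
      Submodule.Quotient.mk_eq_zero, LinearMap.restrictScalars_apply, Ideal.toCotangent_eq_zero]
    exact (hN s).symm

end EmbeddingDimension

/-! ### The module `C/x` and the local ring `S = R + C/x` -/

section Conductor

universe u v

variable {R : Type u} {K : Type v} [CommRing R] [Field K] [Algebra R K]

theorem mem_conductorIdeal {c : R} : c ∈ conductorIdeal R K ↔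
    ∀ b ∈ integralClosure R K, algebraMap R K c * b ∈ (1 : Submodule R K) := by
  simp [conductorIdeal, Submodule.mem_div_iff_forall_mul_mem]

theorem exists_mem_conductorIdeal_of_mul {c : R} (hc : c ∈ conductorIdeal R K) {b : K}
    (hb : b ∈ integralClosure R K) :
    ∃ d ∈ conductorIdeal R K, algebraMap R K d = algebraMap R K c * b := by
  obtain ⟨d, hd⟩ := Submodule.mem_one.mp (mem_conductorIdeal.mp hc b hb)
  refine ⟨d, mem_conductorIdeal.mpr fun b' hb' ↦ ?_, hd⟩
  rw [hd, mul_assoc]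
  exact mem_conductorIdeal.mp hc _ (mul_mem hb hb')

/-- The `R`-submodule `C/x` of `K`, where `C` is the conductor. -/
noncomputable def conductorQuotient (R : Type u) (K : Type v) [CommRing R] [Field K] [Algebra R K]
    (x : R) : Submodule R K :=
  (Submodule.map (Algebra.linearMap R K) (conductorIdeal R K)).map
    (LinearMap.mulLeft R (algebraMap R K x)⁻¹)

theorem mem_conductorQuotient {x : R} (hx0 : algebraMap R K x ≠ 0) {z : K} :
    z ∈ conductorQuotient R K x ↔
      ∃ c ∈ conductorIdeal R K, algebraMap R K c = algebraMap R K x * z := by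
  simp only [conductorQuotient, Submodule.mem_map, exists_exists_and_eq_and,
    Algebra.linearMap_apply, LinearMap.mulLeft_apply]
  refine exists_congr fun c ↦ and_congr_right fun _ ↦ ?_
  rw [inv_mul_eq_iff_eq_mul₀ hx0]

theorem mul_mem_conductorQuotient {x : R} (hx0 : algebraMap R K x ≠ 0) {z b : K}
    (hz : z ∈ conductorQuotient R K x) (hb : b ∈ integralClosure R K) :
    z * b ∈ conductorQuotient R K x := by
  obtain ⟨c, hc, hcz⟩ := (mem_conductorQuotient hx0).mp hz
  obtain ⟨d, hd, hdc⟩ := exists_mem_conductorIdeal_of_mul hc hb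
  exact (mem_conductorQuotient hx0).mpr ⟨d, hd, by rw [hdc, hcz, mul_assoc]⟩

variable [IsLocalRing R] {x : R}

theorem IsOfLeastOrder.exists_eq_mul (hx : IsOfLeastOrder R K x) {y : R}
    (hy : y ∈ maximalIdeal R) :
    ∃ b ∈ integralClosure R K, algebraMap R K y = algebraMap R K x * b := by
  obtain ⟨b, hb⟩ := hx.2 y hy
  exact ⟨b, b.2, congrArg Subtype.val hb⟩

theorem IsOfLeastOrder.exists_eq_sq_mul (hx : IsOfLeastOrder R K x) {y : R}
    (hy : y ∈ maximalIdeal R ^ 2) :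
    ∃ b ∈ integralClosure R K, algebraMap R K y = algebraMap R K x ^ 2 * b := by
  rw [pow_two] at hy
  induction hy using Submodule.mul_induction_on' with
  | mem_mul_mem m hm n hn =>
    obtain ⟨b, hb, hmb⟩ := hx.exists_eq_mul hm
    obtain ⟨b', hb', hnb⟩ := hx.exists_eq_mul hn
    exact ⟨b * b', mul_mem hb hb', by rw [map_mul, hmb, hnb]; ring⟩
  | add y _ z _ hy hz =>
    obtain ⟨b, hb, hmb⟩ := hy
    obtain ⟨b', hb', hnb⟩ := hz
    exact ⟨b + b', add_mem hb hb', by rw [map_add, hmb, hnb]; ring⟩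

theorem IsOfLeastOrder.algebraMap_ne_zero [FaithfulSMul R K] (hx : IsOfLeastOrder R K x)
    (hR : maximalIdeal R ≠ ⊥) : algebraMap R K x ≠ 0 := by
  intro h0
  refine hR ((Submodule.eq_bot_iff _).mpr fun y hy ↦ ?_)
  obtain ⟨b, -, hb⟩ := hx.exists_eq_mul hy
  rw [h0, zero_mul] at hb
  exact (FaithfulSMul.algebraMap_injective R K) (by rw [hb, map_zero])

/-- By integrality every maximal ideal of `R̄` lies over `𝔪`, so `x` is in the Jacobson radical of
`R̄`. -/
theorem exists_mul_one_add_eq_one (hx : x ∈ maximalIdeal R) {b : K}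
    (hb : b ∈ integralClosure R K) :
    ∃ w ∈ integralClosure R K, (1 + algebraMap R K x * b) * w = 1 := by
  let y : integralClosure R K := 1 + algebraMap R (integralClosure R K) x * ⟨b, hb⟩
  have hy : IsUnit y := by
    by_contra hy
    obtain ⟨M, hM, hyM⟩ := exists_max_ideal_of_mem_nonunits hy
    have hcomap := eq_maximalIdeal (Ideal.isMaximal_comap_of_isIntegral_of_isMaximal (R := R) M)
    rw [← hcomap, Ideal.mem_comap] at hx
    refine hM.ne_top ((Ideal.eq_top_iff_one _).mpr ?_)
    have := sub_mem hyM (M.mul_mem_right ⟨b, hb⟩ hx)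
    simpa [y] using this
  obtain ⟨w, hw⟩ := hy.exists_right_inv
  exact ⟨w, w.2, congrArg Subtype.val hw⟩

theorem algebraMap_mul_ne_one (hx : x ∈ maximalIdeal R) {b : K}
    (hb : b ∈ integralClosure R K) : algebraMap R K x * b ≠ 1 := by
  intro h
  obtain ⟨w, -, hw⟩ := exists_mul_one_add_eq_one hx (neg_mem hb)
  rw [mul_neg, h, add_neg_cancel, zero_mul] at hw
  exact zero_ne_one hw

/-- The point where `C ⊆ 𝔪²` matters: `𝔪² ⊆ x²R̄`, and dividing by `x` leaves one factor `x`. -/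
theorem exists_eq_mul_of_mem_conductorQuotient (hx : IsOfLeastOrder R K x)
    (hx0 : algebraMap R K x ≠ 0) (hC : conductorIdeal R K ≤ maximalIdeal R ^ 2) {z : K}
    (hz : z ∈ conductorQuotient R K x) : ∃ b ∈ integralClosure R K, z = algebraMap R K x * b := by
  obtain ⟨c, hc, hcz⟩ := (mem_conductorQuotient hx0).mp hz
  obtain ⟨b, hb, hcb⟩ := hx.exists_eq_sq_mul (hC hc)
  refine ⟨b, hb, mul_left_cancel₀ hx0 ?_⟩
  rw [← hcz, hcb]
  ring

theorem conductorQuotient_le_integralClosure (hx : IsOfLeastOrder R K x)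
    (hx0 : algebraMap R K x ≠ 0) (hC : conductorIdeal R K ≤ maximalIdeal R ^ 2) {z : K}
    (hz : z ∈ conductorQuotient R K x) : z ∈ integralClosure R K := by
  obtain ⟨b, hb, rfl⟩ := exists_eq_mul_of_mem_conductorQuotient hx hx0 hC hz
  exact mul_mem (Subalgebra.algebraMap_mem _ _) hb

/-- The factor `x` in `z ∈ xR̄` cancels the denominator of `w ∈ C/x`, and `C` absorbs the remaining
factor from `R̄`. -/
theorem exists_eq_mul_of_mem_conductorQuotient_mul (hx : IsOfLeastOrder R K x)
    (hx0 : algebraMap R K x ≠ 0) (hC : conductorIdeal R K ≤ maximalIdeal R ^ 2) {z w : K}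
    (hz : z ∈ conductorQuotient R K x) (hw : w ∈ conductorQuotient R K x) :
    ∃ c ∈ conductorIdeal R K, algebraMap R K c = z * w := by
  obtain ⟨b, hb, rfl⟩ := exists_eq_mul_of_mem_conductorQuotient hx hx0 hC hz
  obtain ⟨c, hc, hcw⟩ := (mem_conductorQuotient hx0).mp hw
  obtain ⟨d, hd, hdc⟩ := exists_mem_conductorIdeal_of_mul hc hb
  exact ⟨d, hd, by rw [hdc, hcw]; ring⟩

theorem exists_eq_algebraMap_mul_of_mem_conductorQuotient (hx : IsOfLeastOrder R K x)
    (hx0 : algebraMap R K x ≠ 0) {y : R} (hy : y ∈ maximalIdeal R) {w : K}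
    (hw : w ∈ conductorQuotient R K x) :
    ∃ c ∈ conductorIdeal R K, algebraMap R K c = algebraMap R K y * w := by
  obtain ⟨b, hb, hyb⟩ := hx.exists_eq_mul hy
  obtain ⟨c, hc, hcw⟩ := (mem_conductorQuotient hx0).mp hw
  obtain ⟨d, hd, hdc⟩ := exists_mem_conductorIdeal_of_mul hc hb
  exact ⟨d, hd, by rw [hdc, hcw, hyb]; ring⟩

/-- `R + C/x` is already closed under products, because `C/x` lies in `R̄` and is stable under
multiplication by `R̄`. -/
theorem mem_conductorTransform (hx : IsOfLeastOrder R K x)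
    (hx0 : algebraMap R K x ≠ 0) (hC : conductorIdeal R K ≤ maximalIdeal R ^ 2) {z : K} :
    z ∈ conductorTransform R K x ↔
      ∃ r : R, ∃ w ∈ conductorQuotient R K x, algebraMap R K r + w = z := by
  constructor
  · intro hz
    induction hz using Algebra.adjoin_induction with
    | mem z hz =>
      obtain ⟨c, hc, rfl⟩ := hz
      refine ⟨0, _, (mem_conductorQuotient hx0).mpr ⟨c, hc, ?_⟩, by rw [map_zero, zero_add]⟩
      field_simp
    | algebraMap r => exact ⟨r, 0, zero_mem _, add_zero _⟩
    | add y z _ _ hy hz =>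
      obtain ⟨r, v, hv, rfl⟩ := hy
      obtain ⟨s, w, hw, rfl⟩ := hz
      exact ⟨r + s, v + w, add_mem hv hw, by rw [map_add]; ring⟩
    | mul y z _ _ hy hz =>
      obtain ⟨r, v, hv, rfl⟩ := hy
      obtain ⟨s, w, hw, rfl⟩ := hz
      refine ⟨r * s, r • w + s • v + v * w, add_mem (add_mem (Submodule.smul_mem _ _ hw)
        (Submodule.smul_mem _ _ hv)) (mul_mem_conductorQuotient hx0 hv
          (conductorQuotient_le_integralClosure hx hx0 hC hw)), ?_⟩
      rw [map_mul, Algebra.smul_def, Algebra.smul_def]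
      ring
  · rintro ⟨r, w, hw, rfl⟩
    refine add_mem (Subalgebra.algebraMap_mem _ _) (Algebra.subset_adjoin ?_)
    obtain ⟨c, hc, hcw⟩ := (mem_conductorQuotient hx0).mp hw
    exact ⟨c, hc, by rw [hcw, mul_div_cancel_left₀ _ hx0]⟩

theorem toSubmodule_conductorTransform (hx : IsOfLeastOrder R K x)
    (hx0 : algebraMap R K x ≠ 0) (hC : conductorIdeal R K ≤ maximalIdeal R ^ 2) :
    Subalgebra.toSubmodule (conductorTransform R K x) = 1 ⊔ conductorQuotient R K x := by
  ext z
  rw [Subalgebra.mem_toSubmodule, mem_conductorTransform hx hx0 hC, Submodule.mem_sup]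
  simp [Submodule.mem_one]

/-- The `R`-submodule `𝔪 + C/x` of `K`. -/
noncomputable def maximalIdealAddConductorQuotient (R : Type u) (K : Type v) [CommRing R]
    [IsLocalRing R] [Field K] [Algebra R K] (x : R) : Submodule R K :=
  Submodule.map (Algebra.linearMap R K) (maximalIdeal R) ⊔ conductorQuotient R K x

theorem mem_maximalIdealAddConductorQuotient {z : K} :
    z ∈ maximalIdealAddConductorQuotient R K x ↔
      ∃ y ∈ maximalIdeal R, ∃ w ∈ conductorQuotient R K x, algebraMap R K y + w = z := by
  rw [maximalIdealAddConductorQuotient, Submodule.mem_sup]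
  simp [-mem_maximalIdeal]

theorem exists_eq_mul_of_mem_maximalIdealAddConductorQuotient (hx : IsOfLeastOrder R K x)
    (hx0 : algebraMap R K x ≠ 0) (hC : conductorIdeal R K ≤ maximalIdeal R ^ 2) {z : K}
    (hz : z ∈ maximalIdealAddConductorQuotient R K x) :
    ∃ b ∈ integralClosure R K, z = algebraMap R K x * b := by
  obtain ⟨y, hy, w, hw, rfl⟩ := mem_maximalIdealAddConductorQuotient.mp hz
  obtain ⟨b, hb, hyb⟩ := hx.exists_eq_mul hy
  obtain ⟨b', hb', hwb⟩ := exists_eq_mul_of_mem_conductorQuotient hx hx0 hC hw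
  exact ⟨b + b', add_mem hb hb', by rw [hyb, hwb, mul_add]⟩

theorem conductorTransform_le_integralClosure (hx : IsOfLeastOrder R K x)
    (hx0 : algebraMap R K x ≠ 0) (hC : conductorIdeal R K ≤ maximalIdeal R ^ 2) :
    conductorTransform R K x ≤ integralClosure R K := by
  intro z hz
  obtain ⟨r, w, hw, rfl⟩ := (mem_conductorTransform hx hx0 hC).mp hz
  exact add_mem (Subalgebra.algebraMap_mem _ _)
    (conductorQuotient_le_integralClosure hx hx0 hC hw)

/-- If `r` is a unit of `R`, then `r + w = r(1 + r⁻¹w)` with `r⁻¹w ∈ C/x ⊆ xR̄`, so it is invertible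
in `R̄`, and the inverse falls back into `S`. Conversely `𝔪 + C/x ⊆ xR̄` contains no unit of `S`,
since `S ⊆ R̄`. -/
theorem mem_nonunits_conductorTransform (hx : IsOfLeastOrder R K x)
    (hx0 : algebraMap R K x ≠ 0) (hC : conductorIdeal R K ≤ maximalIdeal R ^ 2)
    {z : conductorTransform R K x} :
    z ∈ nonunits (conductorTransform R K x) ↔
      (z : K) ∈ maximalIdealAddConductorQuotient R K x := by
  constructor
  · intro hz
    obtain ⟨r, w, hw, hrw⟩ := (mem_conductorTransform hx hx0 hC).mp z.2
    refine mem_maximalIdealAddConductorQuotient.mpr ⟨r, ?_, w, hw, hrw⟩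
    by_contra hr
    obtain ⟨u, hu⟩ := (notMem_maximalIdeal.mp hr).exists_right_inv
    have hu' : algebraMap R K r * algebraMap R K u = 1 := by rw [← map_mul, hu, map_one]
    have huw : algebraMap R K u * w ∈ conductorQuotient R K x := by
      rw [← Algebra.smul_def]
      exact Submodule.smul_mem _ _ hw
    obtain ⟨b, hb, hwb⟩ := exists_eq_mul_of_mem_conductorQuotient hx hx0 hC huw
    obtain ⟨v, hv, hvb⟩ := exists_mul_one_add_eq_one hx.1 hb
    rw [← hwb] at hvb
    -- From `(1 + uw)v = 1` follows `v = 1 - (uw)v`, and `(uw)v ∈ C/x` by stability under `R̄`.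
    have hvS : v ∈ conductorTransform R K x := by
      refine (mem_conductorTransform hx hx0 hC).mpr
        ⟨1, _, neg_mem (mul_mem_conductorQuotient hx0 huw hv), ?_⟩
      rw [map_one]
      linear_combination -hvb
    refine hz (IsUnit.of_mul_eq_one (⟨v, hvS⟩ * algebraMap R (conductorTransform R K x) u) ?_)
    apply Subtype.ext
    change (z : K) * (v * algebraMap R K u) = 1
    rw [← hrw]
    linear_combination hvb + v * hu'
  · intro hz hunit
    obtain ⟨v, hv⟩ := hunit.exists_right_inv
    obtain ⟨b, hb, hzb⟩ := exists_eq_mul_of_mem_maximalIdealAddConductorQuotient hx hx0 hC hz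
    refine algebraMap_mul_ne_one hx.1
      (mul_mem hb (conductorTransform_le_integralClosure hx hx0 hC v.2)) ?_
    rw [← mul_assoc, ← hzb]
    exact congrArg Subtype.val hv

theorem isLocalRing_conductorTransform (hx : IsOfLeastOrder R K x)
    (hx0 : algebraMap R K x ≠ 0) (hC : conductorIdeal R K ≤ maximalIdeal R ^ 2) :
    IsLocalRing (conductorTransform R K x) := by
  refine IsLocalRing.of_nonunits_add fun a b ha hb ↦ ?_
  rw [mem_nonunits_conductorTransform hx hx0 hC] at *
  exact add_mem ha hb

theorem mem_maximalIdeal_conductorTransform [IsLocalRing (conductorTransform R K x)]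
    (hx : IsOfLeastOrder R K x)
    (hx0 : algebraMap R K x ≠ 0) (hC : conductorIdeal R K ≤ maximalIdeal R ^ 2)
    {z : conductorTransform R K x} :
    z ∈ maximalIdeal (conductorTransform R K x) ↔
      (z : K) ∈ maximalIdealAddConductorQuotient R K x :=
  mem_nonunits_conductorTransform hx hx0 hC

theorem maximalIdealAddConductorQuotient_le (hx : IsOfLeastOrder R K x)
    (hx0 : algebraMap R K x ≠ 0) (hC : conductorIdeal R K ≤ maximalIdeal R ^ 2) :
    maximalIdealAddConductorQuotient R K x ≤
      Subalgebra.toSubmodule (conductorTransform R K x) := by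
  intro z hz
  obtain ⟨y, -, w, hw, rfl⟩ := mem_maximalIdealAddConductorQuotient.mp hz
  exact (mem_conductorTransform hx hx0 hC).mpr ⟨y, w, hw, rfl⟩

theorem surjective_algebraMap_residueField_conductorTransform
    [IsLocalRing (conductorTransform R K x)] (hx : IsOfLeastOrder R K x)
    (hx0 : algebraMap R K x ≠ 0) (hC : conductorIdeal R K ≤ maximalIdeal R ^ 2) :
    Function.Surjective (algebraMap R (ResidueField (conductorTransform R K x))) := by
  intro t
  obtain ⟨z, rfl⟩ := residue_surjective t
  obtain ⟨r, w, hw, hrw⟩ := (mem_conductorTransform hx hx0 hC).mp z.2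
  refine ⟨r, ?_⟩
  change residue _ (algebraMap R (conductorTransform R K x) r) = residue _ z
  rw [← sub_eq_zero, ← map_sub, residue_eq_zero_iff,
    mem_maximalIdeal_conductorTransform hx hx0 hC]
  refine mem_maximalIdealAddConductorQuotient.mpr ⟨0, zero_mem _, -w, neg_mem hw, ?_⟩
  change _ = algebraMap R K r - z
  rw [← hrw, map_zero]
  ring

/-- In a product of two elements of `𝔪 + C/x`, every term other than the one from `𝔪·𝔪` lies in `C ⊆
𝔪²`. Thus passing to `S` adds nothing to the square of the maximal ideal. -/
theorem mem_maximalIdeal_sq_conductorTransform [IsLocalRing (conductorTransform R K x)]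
    (hx : IsOfLeastOrder R K x)
    (hx0 : algebraMap R K x ≠ 0) (hC : conductorIdeal R K ≤ maximalIdeal R ^ 2)
    {z : conductorTransform R K x} :
    z ∈ maximalIdeal (conductorTransform R K x) ^ 2 ↔
      (z : K) ∈ Submodule.map (Algebra.linearMap R K) (maximalIdeal R ^ 2 : Ideal R) := by
  have hmem {y z : K} (hy : y ∈ maximalIdealAddConductorQuotient R K x)
      (hz : z ∈ maximalIdealAddConductorQuotient R K x) :
      ∃ a ∈ maximalIdeal R ^ 2, algebraMap R K a = y * z := by
    obtain ⟨y, hy', v, hv, rfl⟩ := mem_maximalIdealAddConductorQuotient.mp hy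
    obtain ⟨z, hz', w, hw, rfl⟩ := mem_maximalIdealAddConductorQuotient.mp hz
    obtain ⟨c, hcC, hc⟩ := exists_eq_mul_of_mem_conductorQuotient_mul hx hx0 hC hv hw
    obtain ⟨d, hdC, hd⟩ := exists_eq_algebraMap_mul_of_mem_conductorQuotient hx hx0 hy' hw
    obtain ⟨e, heC, he⟩ := exists_eq_algebraMap_mul_of_mem_conductorQuotient hx hx0 hz' hv
    refine ⟨y * z + c + d + e, add_mem (add_mem (add_mem ?_ (hC hcC)) (hC hdC)) (hC heC), ?_⟩
    · rw [pow_two]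
      exact Ideal.mul_mem_mul hy' hz'
    · rw [map_add, map_add, map_add, map_mul, hc, hd, he]
      ring
  constructor
  · intro hz
    rw [pow_two] at hz
    induction hz using Submodule.mul_induction_on' with
    | mem_mul_mem m hm n hn =>
      rw [mem_maximalIdeal_conductorTransform hx hx0 hC] at hm hn
      exact hmem hm hn
    | add y _ z _ hy hz => exact add_mem hy hz
  · rintro ⟨a, ha, haz⟩
    obtain rfl : algebraMap R (conductorTransform R K x) a = z := Subtype.ext haz
    have hle : maximalIdeal R ≤ (maximalIdeal (conductorTransform R K x)).comap
        (algebraMap R (conductorTransform R K x)) := fun y hy ↦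
      (mem_maximalIdeal_conductorTransform hx hx0 hC).mpr
        (mem_maximalIdealAddConductorQuotient.mpr ⟨y, hy, 0, zero_mem _, add_zero _⟩)
    exact Ideal.le_comap_pow _ 2 (Ideal.pow_right_mono hle 2 ha)

theorem finite_conductorTransform [IsNoetherianRing R] (hx : IsOfLeastOrder R K x)
    (hx0 : algebraMap R K x ≠ 0) (hC : conductorIdeal R K ≤ maximalIdeal R ^ 2) :
    Module.Finite R (conductorTransform R K x) := by
  have h : (Subalgebra.toSubmodule (conductorTransform R K x)).FG := by
    rw [toSubmodule_conductorTransform hx hx0 hC, Submodule.one_eq_range]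
    refine Submodule.FG.sup ?_ ?_
    · rw [LinearMap.range_eq_map]
      exact Submodule.FG.map _ Module.Finite.fg_top
    · exact ((IsNoetherian.noetherian (conductorIdeal R K)).map _).map _
  exact Module.Finite.iff_fg.mpr h

end Conductor

/-! ### Change of base ring for lengths -/

theorem length_eq_finrank_of_smul_eq_zero {k R M : Type*} [Field k] [CommRing R] [IsLocalRing R]
    [Algebra k R] (hres : Function.Surjective (algebraMap k (ResidueField R))) [AddCommGroup M]
    [Module R M] [Module k M] [IsScalarTower k R M] [Module.Finite R M]
    (h : ∀ r ∈ maximalIdeal R, ∀ v : M, r • v = 0) :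
    Module.length R M = Module.finrank k M := by
  have htors : Module.IsTorsionBySet R M (maximalIdeal R : Set R) := fun v r ↦ h r r.2 v
  let : Module (ResidueField R) M := htors.module
  have : IsScalarTower R (ResidueField R) M := htors.isScalarTower
  have : IsScalarTower k (ResidueField R) M := htors.isScalarTower
  have : Module.Finite (ResidueField R) M := Module.Finite.of_restrictScalars_finite R _ _
  have : Module.Finite k (ResidueField R) :=
    Module.Finite.of_surjective (Algebra.linearMap k (ResidueField R)) hres
  have : Module.Finite k M := Module.Finite.trans (ResidueField R) M
  rw [Module.length_eq_of_surjective (R := ResidueField R) IsLocalRing.residue_surjective,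
    ← Module.length_eq_of_surjective (S := k) hres, Module.length_eq_finrank]

/-- The type of the overring is an `S`-length, while the counting argument is carried out over `R`;
an inequality in this direction suffices. -/
theorem length_quotient_submoduleOf_le_restrictScalars {R S M : Type*} [Ring R] [Ring S]
    [AddCommGroup M] [SMul R S] [Module S M] [Module R M] [IsScalarTower R S M]
    {P T : Submodule S M} {N : Submodule R M} (hN : ∀ z, z ∈ P ↔ z ∈ N) :
    Module.length S (T ⧸ P.submoduleOf T) ≤
      Module.length R (T.restrictScalars R ⧸ N.submoduleOf (T.restrictScalars R)) := by
  refine (length_le_length_of_isScalarTower (R := R)).trans (le_of_eq ?_)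
  let f : T.restrictScalars R →ₗ[R] T ⧸ P.submoduleOf T :=
    { toFun z := (P.submoduleOf T).mkQ ⟨z, z.2⟩
      map_add' _ _ := rfl
      map_smul' _ _ := rfl }
  refine length_eq_of_surjective_of_ker_eq (f := f) (g := Submodule.mkQ _)
    (Submodule.mkQ_surjective (P.submoduleOf T)) (Submodule.mkQ_surjective _) ?_
  ext z
  rw [Submodule.ker_mkQ, LinearMap.mem_ker]
  exact (Submodule.Quotient.mk_eq_zero (P.submoduleOf T)).trans (hN z)

theorem cmType_le_length_of_isScalarTower {R S F : Type*} [CommRing R] [CommRing S] [IsDomain S]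
    [IsLocalRing S] [IsNoetherianRing S] [Ring.DimensionLEOne S] [Field F] [Algebra R S]
    [Algebra S F] [Algebra R F] [IsScalarTower R S F] [FaithfulSMul S F]
    (hS : maximalIdeal S ≠ ⊥) {N : Submodule R F} (hN : ∀ z, z ∈ (1 : Submodule S F) ↔ z ∈ N) :
    cmType S ≤ Module.length R ((colonMaximalIdeal S F).restrictScalars R ⧸
      N.submoduleOf ((colonMaximalIdeal S F).restrictScalars R)) := by
  rw [cmType_eq_length (F := F) hS]
  exact length_quotient_submoduleOf_le_restrictScalars hN

/-! ### Length of `S/R`, embedding dimension and type of `S` -/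

section ConductorTransform

universe u v

variable {R : Type u} {K : Type v} [CommRing R] [IsLocalRing R] [Field K] [Algebra R K] {x : R}

/-- Both modules are quotients of `(C, x)`, via `d ↦ d/x` and `d ↦ d mod x`; the kernels agree since
`d/x ∈ R` exactly when `d ∈ (x)`. -/
theorem length_conductorTransform_quotient_one_eq_length_map (hx : IsOfLeastOrder R K x)
    (hx0 : algebraMap R K x ≠ 0) (hC : conductorIdeal R K ≤ maximalIdeal R ^ 2)
    [FaithfulSMul R K] :
    Module.length R (Subalgebra.toSubmodule (conductorTransform R K x) ⧸
        (1 : Submodule R K).submoduleOf (Subalgebra.toSubmodule (conductorTransform R K x))) =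
      Module.length R
        ((conductorIdeal R K ⊔ Ideal.span {x}).map (Ideal.Quotient.mk (Ideal.span {x}))) := by
  have hmem (d : R) (hd : d ∈ conductorIdeal R K ⊔ Ideal.span {x}) :
      (algebraMap R K x)⁻¹ * algebraMap R K d ∈ conductorTransform R K x := by
    obtain ⟨c, hc, e, he, rfl⟩ := Submodule.mem_sup.mp hd
    obtain ⟨r, rfl⟩ := Ideal.mem_span_singleton.mp he
    refine (mem_conductorTransform hx hx0 hC).mpr ⟨r, (algebraMap R K x)⁻¹ * algebraMap R K c,
      (mem_conductorQuotient hx0).mpr ⟨c, hc, by field_simp⟩, ?_⟩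
    rw [map_add, map_mul]
    field_simp
    ring
  let f : ↥(conductorIdeal R K ⊔ Ideal.span {x}) →ₗ[R]
      Subalgebra.toSubmodule (conductorTransform R K x) :=
    (LinearMap.mulLeft R (algebraMap R K x)⁻¹ ∘ₗ Algebra.linearMap R K ∘ₗ
      Submodule.subtype _).codRestrict _ fun d ↦ hmem d d.2
  let g : ↥(conductorIdeal R K ⊔ Ideal.span {x}) →ₗ[R]
      ((conductorIdeal R K ⊔ Ideal.span {x}).map (Ideal.Quotient.mk (Ideal.span {x}))) :=
    ((Ideal.Quotient.mkₐ R (Ideal.span {x})).toLinearMap ∘ₗ Submodule.subtype _).codRestrict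
      (Submodule.restrictScalars R
        ((conductorIdeal R K ⊔ Ideal.span {x}).map (Ideal.Quotient.mk (Ideal.span {x}))))
      fun d ↦ Ideal.mem_map_of_mem _ d.2
  refine length_eq_of_surjective_of_ker_eq (f := Submodule.mkQ _ ∘ₗ f) (g := g) ?_ ?_ ?_
  · rintro z
    obtain ⟨⟨z, hz⟩, rfl⟩ := Submodule.mkQ_surjective _ z
    obtain ⟨r, w, hw, rfl⟩ := (mem_conductorTransform hx hx0 hC).mp hz
    obtain ⟨c, hc, hcw⟩ := (mem_conductorQuotient hx0).mp hw
    refine ⟨⟨c, Submodule.mem_sup_left hc⟩, ?_⟩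
    rw [LinearMap.comp_apply, ← sub_eq_zero, ← map_sub, Submodule.mkQ_apply,
      Submodule.Quotient.mk_eq_zero]
    change (algebraMap R K x)⁻¹ * algebraMap R K c - (algebraMap R K r + w) ∈ (1 : Submodule R K)
    refine Submodule.mem_one.mpr ⟨-r, ?_⟩
    rw [hcw, inv_mul_cancel_left₀ hx0, map_neg]
    ring
  · rintro ⟨z, hz⟩
    obtain ⟨d, hd, rfl⟩ := (Ideal.mem_map_iff_of_surjective _ Ideal.Quotient.mk_surjective).mp hz
    exact ⟨⟨d, hd⟩, rfl⟩
  · ext d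
    rw [LinearMap.mem_ker, LinearMap.comp_apply, Submodule.mkQ_apply,
      Submodule.Quotient.mk_eq_zero, LinearMap.mem_ker, ← Subtype.coe_inj]
    change (algebraMap R K x)⁻¹ * algebraMap R K d ∈ (1 : Submodule R K) ↔
      Ideal.Quotient.mk (Ideal.span {x}) (d : R) = 0
    rw [Ideal.Quotient.eq_zero_iff_mem, Ideal.mem_span_singleton, Submodule.mem_one]
    refine exists_congr fun r ↦ ?_
    rw [eq_inv_mul_iff_mul_eq₀ hx0, ← map_mul, (FaithfulSMul.algebraMap_injective R K).eq_iff,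
      eq_comm]

theorem length_conductorTransform_quotient_one {k : Type*} [Field k] [Algebra k R]
    [IsNoetherianRing R] (hres : Function.Surjective (algebraMap k (ResidueField R)))
    (hx : IsOfLeastOrder R K x)
    (hx0 : algebraMap R K x ≠ 0) (hC : conductorIdeal R K ≤ maximalIdeal R ^ 2)
    [FaithfulSMul R K] :
    Module.length R (Subalgebra.toSubmodule (conductorTransform R K x) ⧸
        (1 : Submodule R K).submoduleOf (Subalgebra.toSubmodule (conductorTransform R K x))) =
      reducedType k R K x := by
  rw [length_conductorTransform_quotient_one_eq_length_map hx hx0 hC, reducedType]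
  have : Module.Finite R
      ((conductorIdeal R K ⊔ Ideal.span {x}).map (Ideal.Quotient.mk (Ideal.span {x}))) :=
    Module.Finite.iff_fg.mpr (IsNoetherian.noetherian <| Submodule.restrictScalars R
        ((conductorIdeal R K ⊔ Ideal.span {x}).map (Ideal.Quotient.mk (Ideal.span {x}))))
  refine length_eq_finrank_of_smul_eq_zero hres ?_
  rintro y hy ⟨z, hz⟩
  obtain ⟨d, hd, rfl⟩ := (Ideal.mem_map_iff_of_surjective _ Ideal.Quotient.mk_surjective).mp hz
  apply Subtype.ext
  change Ideal.Quotient.mk (Ideal.span {x}) (y * d) = 0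
  rw [Ideal.Quotient.eq_zero_iff_mem]
  obtain ⟨c, hc, e, he, rfl⟩ := Submodule.mem_sup.mp hd
  rw [mul_add]
  refine add_mem ?_ (Ideal.mul_mem_left _ _ he)
  -- With `y = xb`, `b ∈ R̄`, one gets `yc = x(bc)` and `bc ∈ C ⊆ R`; so `𝔪` kills `(C, x)/(x)`.
  obtain ⟨b, hb, hyb⟩ := hx.exists_eq_mul hy
  obtain ⟨c', -, hc'⟩ := exists_mem_conductorIdeal_of_mul hc hb
  refine Ideal.mem_span_singleton.mpr ⟨c', FaithfulSMul.algebraMap_injective R K ?_⟩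
  rw [map_mul, map_mul, hyb, hc']
  ring

/-- Additivity of length along `𝔪² ⊆ 𝔪 ⊆ 𝔪 + C/x`. The upper quotient is `S/R`, as `C/x` surjects
onto `S/R` and `(𝔪 + C/x) ∩ R = 𝔪`. -/
theorem edim_conductorTransform [IsNoetherianRing R] [FaithfulSMul R K]
    [IsLocalRing (conductorTransform R K x)] [IsNoetherianRing (conductorTransform R K x)]
    (hx : IsOfLeastOrder R K x)
    (hx0 : algebraMap R K x ≠ 0) (hC : conductorIdeal R K ≤ maximalIdeal R ^ 2) :
    (edim (conductorTransform R K x) : ℕ∞) = edim R +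
      Module.length R (Subalgebra.toSubmodule (conductorTransform R K x) ⧸
        (1 : Submodule R K).submoduleOf (Subalgebra.toSubmodule (conductorTransform R K x))) := by
  have hinj := FaithfulSMul.algebraMap_injective R K
  have hR (I : Ideal R) (r : R) :
      Algebra.linearMap R K r ∈ Submodule.map (Algebra.linearMap R K) I ↔ r ∈ I :=
    ⟨fun ⟨_, hs, h⟩ ↦ hinj h ▸ hs, Submodule.mem_map_of_mem⟩
  have hSle := maximalIdealAddConductorQuotient_le hx hx0 hC
  rw [edim_eq_length_quotient (R := R) (S := R) (V := K) IsLocalRing.residue_surjective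
      (Algebra.linearMap R K) (hR (maximalIdeal R)) (LinearMap.map_le_range)
      (hR (maximalIdeal R ^ 2)),
    edim_eq_length_quotient (R := R) (V := K)
      (surjective_algebraMap_residueField_conductorTransform hx hx0 hC)
      (conductorTransform R K x).val.toLinearMap
      (fun s ↦ (mem_maximalIdeal_conductorTransform hx hx0 hC).symm)
      (fun z hz ↦ ⟨⟨z, hSle hz⟩, rfl⟩)
      (fun s ↦ (mem_maximalIdeal_sq_conductorTransform hx hx0 hC).symm),
    length_quotient_submoduleOf_add (Submodule.map_mono (Ideal.pow_le_self two_ne_zero))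
      (show Submodule.map (Algebra.linearMap R K) (maximalIdeal R) ≤
        maximalIdealAddConductorQuotient R K x from le_sup_left)]
  congr 1
  refine length_eq_of_surjective_of_ker_eq (Submodule.mkQ_surjective _)
    (g := Submodule.mkQ _ ∘ₗ Submodule.inclusion hSle) ?_ ?_
  · intro z
    obtain ⟨⟨z, hz⟩, rfl⟩ := Submodule.mkQ_surjective _ z
    obtain ⟨r, w, hw, rfl⟩ := (mem_conductorTransform hx hx0 hC).mp hz
    refine ⟨⟨w, Submodule.mem_sup_right hw⟩, ?_⟩
    rw [LinearMap.comp_apply, ← sub_eq_zero, ← map_sub, Submodule.mkQ_apply,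
      Submodule.Quotient.mk_eq_zero]
    change w - (algebraMap R K r + w) ∈ (1 : Submodule R K)
    exact Submodule.mem_one.mpr ⟨-r, by rw [map_neg]; ring⟩
  · ext z
    rw [Submodule.ker_mkQ, LinearMap.mem_ker, LinearMap.comp_apply, Submodule.mkQ_apply,
      Submodule.Quotient.mk_eq_zero]
    change (z : K) ∈ Submodule.map (Algebra.linearMap R K) (maximalIdeal R) ↔
      (z : K) ∈ (1 : Submodule R K)
    constructor
    · rintro ⟨r, -, hr⟩
      exact Submodule.mem_one.mpr ⟨r, hr⟩
    · intro hz
      obtain ⟨r, hr⟩ := Submodule.mem_one.mp hz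
      refine ⟨r, ?_, hr⟩
      -- A unit of `R` lying in `𝔪 + C/x ⊆ xR̄` would make `x` invertible in `R̄`.
      by_contra hrm
      obtain ⟨u, hu⟩ := (notMem_maximalIdeal.mp hrm).exists_right_inv
      obtain ⟨b, hb, hzb⟩ := exists_eq_mul_of_mem_maximalIdealAddConductorQuotient hx hx0 hC z.2
      refine algebraMap_mul_ne_one hx.1 (mul_mem hb (Subalgebra.algebraMap_mem _ u)) ?_
      rw [← mul_assoc, ← hzb, ← hr, ← map_mul, hu, map_one]

/-- The left side is the length of `T/R` with `T = S : 𝔪_S`. It is recomputed through `T ∩ (R : 𝔪)`,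
whose quotient by `R` embeds in `(R : 𝔪)/R`. -/
theorem length_colonMaximalIdeal_conductorTransform_add_le [IsNoetherianRing R]
    [IsLocalRing (conductorTransform R K x)] (hx : IsOfLeastOrder R K x)
    (hx0 : algebraMap R K x ≠ 0) (hC : conductorIdeal R K ≤ maximalIdeal R ^ 2) :
    Module.length R ((colonMaximalIdeal (conductorTransform R K x) K).restrictScalars R ⧸
        (Subalgebra.toSubmodule (conductorTransform R K x)).submoduleOf
          ((colonMaximalIdeal (conductorTransform R K x) K).restrictScalars R)) +
      Module.length R (Subalgebra.toSubmodule (conductorTransform R K x) ⧸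
        (1 : Submodule R K).submoduleOf (Subalgebra.toSubmodule (conductorTransform R K x))) ≤
      Module.length R (colonMaximalIdeal R K ⧸
        (1 : Submodule R K).submoduleOf (colonMaximalIdeal R K)) +
      edim R * Module.length R (Subalgebra.toSubmodule (conductorTransform R K x) ⧸
        (1 : Submodule R K).submoduleOf (Subalgebra.toSubmodule (conductorTransform R K x))) := by
  set S := conductorTransform R K x with hS
  let T : Submodule R K := (colonMaximalIdeal S K).restrictScalars R
  have hTS {z y : K} (hz : z ∈ T) (hy : y ∈ maximalIdealAddConductorQuotient R K x) :
      z * y ∈ S := by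
    obtain ⟨a, ha⟩ := mem_colonMaximalIdeal.mp hz
      ⟨y, maximalIdealAddConductorQuotient_le hx hx0 hC hy⟩
      ((mem_maximalIdeal_conductorTransform hx hx0 hC).mpr hy)
    rw [show z * y = a from ha.symm]
    exact a.2
  have h1S : (1 : Submodule R K) ≤ Subalgebra.toSubmodule S := Submodule.one_le.mpr (one_mem S)
  have hST : Subalgebra.toSubmodule S ≤ T := fun z hz ↦
    one_le_colonMaximalIdeal (Submodule.mem_one.mpr ⟨⟨z, hz⟩, rfl⟩)
  rw [add_comm, ← length_quotient_submoduleOf_add h1S hST,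
    length_quotient_submoduleOf_add (B := T ⊓ colonMaximalIdeal R K)
      (le_inf (h1S.trans hST) one_le_colonMaximalIdeal) inf_le_left]
  refine add_le_add ?_ ?_
  · refine length_quotient_le_of_ker_le
      (Submodule.mkQ _ ∘ₗ Submodule.inclusion inf_le_right) fun z hz ↦ ?_
    rw [LinearMap.mem_ker, LinearMap.comp_apply, Submodule.mkQ_apply,
      Submodule.Quotient.mk_eq_zero] at hz
    exact hz
  · let G := (maximalIdeal R).generators
    have hfg : (maximalIdeal R).FG := IsNoetherian.noetherian _
    -- `G` is a minimal generating set of `𝔪`, so by Nakayama it has exactly `edim R` elements.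
    have hGm {y : R} (hy : y ∈ G) : y ∈ maximalIdeal R := by
      rw [← Submodule.span_generators (maximalIdeal R)]
      exact Submodule.subset_span hy
    have hG : Finite G := Submodule.FG.finite_generators hfg
    have hcard : ENat.card G = edim R := by
      rw [edim, ← spanFinrank_maximalIdeal_eq_finrank_cotangentSpace, ← Submodule.FG.generators_ncard hfg,
        ENat.card_eq_coe_natCard, Nat.card_coe_set_eq]
    rw [← hcard, ← Module.length_pi]
    -- Multiplication by a generator of `𝔪 ⊆ 𝔪_S` sends `T` into `S`. If all these products lie in
    -- `R`, then `z𝔪 ⊆ R`, so the kernel of the joint map to `(S/R)ⁿ` is inside `R : 𝔪`.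
    let g : G → T →ₗ[R] Subalgebra.toSubmodule S := fun y ↦
      (LinearMap.mulRight R (algebraMap R K y) ∘ₗ T.subtype).codRestrict _ fun z ↦
        hTS z.2 (Submodule.mem_sup_left (Submodule.mem_map_of_mem (hGm y.2)))
    refine length_quotient_le_of_ker_le
      (LinearMap.pi fun y ↦ Submodule.mkQ _ ∘ₗ g y) fun z hz ↦ ?_
    refine ⟨z.2, mem_colonMaximalIdeal.mpr fun m hm ↦ ?_⟩
    rw [← Submodule.span_generators (maximalIdeal R)] at hm
    induction hm using Submodule.span_induction with
    | mem y hy =>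
      have := congrFun (LinearMap.mem_ker.mp hz) ⟨y, hy⟩
      rw [LinearMap.pi_apply, LinearMap.comp_apply, Submodule.mkQ_apply, Pi.zero_apply,
        Submodule.Quotient.mk_eq_zero] at this
      exact Submodule.mem_one.mp this
    | zero => exact ⟨0, by simp⟩
    | add y y' _ _ hy hy' =>
      obtain ⟨a, ha⟩ := hy
      obtain ⟨a', ha'⟩ := hy'
      exact ⟨a + a', by rw [map_add, map_add, ha, ha', mul_add]⟩
    | smul r y _ hy =>
      obtain ⟨a, ha⟩ := hy
      exact ⟨r * a, by rw [smul_eq_mul, map_mul, map_mul, ha]; ring⟩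

end ConductorTransform

/-! ### The main theorem -/

theorem mainTheorem9 {k : Type*} [Field k] [IsAlgClosed k] [CharZero k]
    {R : Type*} [CommRing R] [IsDomain R] [IsLocalRing R] [IsNoetherianRing R]
    [IsAdicComplete (maximalIdeal R) R] (hdim : ringKrullDim R = 1)
    [Algebra k R] (hres : Function.Bijective (algebraMap k (ResidueField R)))
    {K : Type*} [Field K] [Algebra R K] [IsFractionRing R K]
    (x : R) (hx : IsOfLeastOrder R K x)
    (hC : conductorIdeal R K ≤ maximalIdeal R ^ 2) :
    ∃ _ : IsLocalRing (conductorTransform R K x),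
      IsNoetherianRing (conductorTransform R K x) ∧
      edim (conductorTransform R K x) = edim R + reducedType k R K x ∧
      cmType (conductorTransform R K x) ≤
        cmType R + ((reducedType k R K x * (edim R - 1) : ℕ) : ℕ∞) := by
  have : FaithfulSMul R K := (faithfulSMul_iff_algebraMap_injective R K).mpr
    (IsFractionRing.injective R K)
  have hfield : ¬ IsField R := fun h ↦ by
    rw [ringKrullDim_eq_zero_of_isField h] at hdim
    exact zero_ne_one hdim
  have hR : maximalIdeal R ≠ ⊥ := fun h ↦ hfield (isField_iff_maximalIdeal_eq.mpr h)
  have hdim1 : Ring.KrullDimLE 1 R := Ring.krullDimLE_iff.mpr (by exact_mod_cast hdim.le)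
  have : Ring.DimensionLEOne R := ⟨fun h0 hp ↦ hp.isMaximal_of_ne_bot h0⟩
  have hx0 : algebraMap R K x ≠ 0 := hx.algebraMap_ne_zero hR
  have : Module.Finite R (conductorTransform R K x) := finite_conductorTransform hx hx0 hC
  have : IsNoetherianRing (conductorTransform R K x) := IsNoetherianRing.of_finite R _
  have : Ring.DimensionLEOne (conductorTransform R K x) := Ring.DimensionLEOne.of_isIntegral R _
  have hloc := isLocalRing_conductorTransform hx hx0 hC
  have : FaithfulSMul (conductorTransform R K x) K :=
    (faithfulSMul_iff_algebraMap_injective _ K).mpr Subtype.val_injective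
  have hs := length_conductorTransform_quotient_one hres.2 hx hx0 hC
  refine ⟨hloc, inferInstance, ?_, ?_⟩
  · have := edim_conductorTransform hx hx0 hC
    rw [hs] at this
    exact_mod_cast this
  · have hS : maximalIdeal (conductorTransform R K x) ≠ ⊥ := fun h ↦ by
      have hxm : algebraMap R (conductorTransform R K x) x ∈
          maximalIdeal (conductorTransform R K x) :=
        (mem_maximalIdeal_conductorTransform hx hx0 hC).mpr
          (Submodule.mem_sup_left (Submodule.mem_map_of_mem hx.1))
      rw [h, Ideal.mem_bot] at hxm
      exact hx0 (congrArg Subtype.val hxm)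
    have hle := length_colonMaximalIdeal_conductorTransform_add_le hx hx0 hC
    rw [← cmType_eq_length hR, hs] at hle
    have htype := cmType_le_length_of_isScalarTower (R := R) (F := K) hS
      (N := Subalgebra.toSubmodule (conductorTransform R K x)) fun z ↦ Submodule.mem_one.trans
        ⟨fun ⟨y, hy⟩ ↦ hy ▸ y.2, fun hz ↦ ⟨⟨z, hz⟩, rfl⟩⟩
    replace hle := (add_le_add_left htype _).trans hle
    -- `edim R ≥ 1` because `R` is not a field, so the subtraction `edim R - 1` is not truncated;
    -- the finite summand `s` can then be cancelled in `ℕ∞`.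
    obtain ⟨n, hn⟩ := Nat.exists_eq_succ_of_ne_zero
      (fun h : edim R = 0 ↦ hfield (finrank_cotangentSpace_eq_zero_iff.mp h))
    rw [hn] at hle ⊢
    refine (ENat.add_le_add_iff_right (ENat.natCast_ne_top (reducedType k R K x))).mp
      (hle.trans (le_of_eq ?_))
    rw [add_assoc]
    congr 1
    norm_cast
    rw [Nat.succ_sub_one, Nat.succ_mul, mul_comm, add_comm]
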